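/- For a Borel probability measure $\nu$ on $\mathbb{C}$ with compact support let $I(\nu)=\int\!\int \log|z-w|\,d\nu(w)\,d\nu(z)\in[-\infty,\infty)$ be its logarithmic energy. For $B\subset\mathbb{C}$ let $I(B)$ be the supremum of $I(\nu)$ over all Borel probability measures $\nu$ with compact support contained in $B$; the set $B$ is called polar if its logarithmic capacity $\operatorname{Cap}(B)=e^{I(B)}$ is $0$. Let $\mathcal{B}$ be the set of Borel probability measures $\mu$ on $\mathbb{C}$ whose support $S(\mu)$ is compact and non-polar. For $\mu\in\mathcal{B}$ let $P_n(z)=\gamma_n z^n+\text{lower order terms}$, with $\gamma_n>0$ and $n\ge 0$, be the orthonormal polynomials of $\mu$ in $L^2(\mu)$. For a compact set $S\subset\mathbb{C}$ let $K(S)=\mathbb{C}\setminus\Omega(S)$, where $\Omega(S)$ is the unbounded connected component of $\mathbb{C}\setminus S$. **Proposition.** For every $R>0$, every $\mu\in\mathcal{B}$ and every compact set $V\subset\mathbb{C}$ with $V\cap K(S(\mu))=\emptyset$ there exists $M=M(R,\mu,V)\in\mathbb{N}$ such that, for every $n\ge 1$ and every $w\in\mathbb{C}$ with $|w|\le R$,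 the number of preimages of $w$ in $V$ under $P_n$ is less than $M$: $$\#\bigl(P_n^{-1}(w)\cap V\bigr)<M,$$ and this also holds when the preimages are counted with multiplicity. -/

import Mathlib

open Polynomial MeasureTheory

noncomputable section

/-- The part `∫∫ log⁺ |z - w| dν(w) dν(z)` of the logarithmic energy. -/
def logEnergyPos (ν : Measure ℂ) : ENNReal :=
  ∫⁻ z, ∫⁻ w, (ENNReal.log ‖z - w‖ₑ).toENNReal ∂ν ∂ν

/-- The part `∫∫ log⁻ |z - w| dν(w) dν(z)` of the logarithmic energy. The integrand is `+∞` on the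
diagonal, since `ENNReal.log 0 = -∞`. -/
def logEnergyNeg (ν : Measure ℂ) : ENNReal :=
  ∫⁻ z, ∫⁻ w, (-ENNReal.log ‖z - w‖ₑ).toENNReal ∂ν ∂ν

/-- The logarithmic energy `I(ν) = ∫∫ log |z - w| dν(w) dν(z)`, an element of `[-∞, ∞)` when `ν` is a
probability measure with compact support (its positive part is then finite). -/
def logEnergy (ν : Measure ℂ) : EReal :=
  (logEnergyPos ν : EReal) - (logEnergyNeg ν : EReal)

/-- The energy `I(B)`: the supremum of `I(ν)` over the Borel probability measures `ν` with compact
support contained in `B` (it is `-∞` if there are none). -/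
def setEnergy (B : Set ℂ) : EReal :=
  sSup {e : EReal | ∃ ν : Measure ℂ, IsProbabilityMeasure ν ∧ IsCompact ν.support ∧
    ν.support ⊆ B ∧ e = logEnergy ν}

/-- The logarithmic capacity `Cap B = exp (I(B))`, with `exp (-∞) = 0`. -/
def logCap (B : Set ℂ) : ENNReal := EReal.exp (setEnergy B)

/-- A set is polar if its logarithmic capacity vanishes. -/
def IsPolar (B : Set ℂ) : Prop := logCap B = 0

/-- The class of Borel probability measures on `ℂ` with compact non-polar support. -/
structure MemClassB (μ : Measure ℂ) : Prop where
  isProbabilityMeasure : IsProbabilityMeasure μ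
  isCompact_support : IsCompact μ.support
  not_isPolar_support : ¬ IsPolar μ.support

/-- The unbounded connected component `Ω(S)` of `ℂ \ S` (for `S` compact there is exactly one). -/
def unboundedComponent (S : Set ℂ) : Set ℂ :=
  {z | z ∈ Sᶜ ∧ ¬ Bornology.IsBounded (connectedComponentIn Sᶜ z)}

/-- The filled set `K(S) = ℂ \ Ω(S)`. -/
def filledSet (S : Set ℂ) : Set ℂ := (unboundedComponent S)ᶜ

/-- The inner product `∫ conj (p z) * q z dμ(z)` of two polynomials in `L²(μ)`. -/
def polyInner (μ : Measure ℂ) (p q : ℂ[X]) : ℂ :=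
  ∫ z, (starRingEnd ℂ) (p.eval z) * q.eval z ∂μ

/-- The norm of a polynomial in `L²(μ)`. -/
def polyNorm (μ : Measure ℂ) (p : ℂ[X]) : ℝ :=
  Real.sqrt (∫ z, ‖p.eval z‖ ^ 2 ∂μ)

/-- The monic orthogonal polynomials of `μ`: the Gram-Schmidt process in `L²(μ)` applied to
`1, X, X ^ 2, …`. -/
def monicOrthogonalPoly (μ : Measure ℂ) (n : ℕ) : ℂ[X] :=
  X ^ n - ∑ k : Fin n,
    C (polyInner μ (monicOrthogonalPoly μ k) (X ^ n) /
        polyInner μ (monicOrthogonalPoly μ k) (monicOrthogonalPoly μ k)) *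
      monicOrthogonalPoly μ k
termination_by n
decreasing_by exact k.2

/-- The orthonormal polynomials `P_n = γ_n X ^ n + …` of `μ`, with leading coefficient
`γ_n = 1 / ‖p_n‖ > 0`, where `p_n` is the monic orthogonal polynomial of degree `n`. -/
def orthonormalPoly (μ : Measure ℂ) (n : ℕ) : ℂ[X] :=
  C (((polyNorm μ (monicOrthogonalPoly μ n))⁻¹ : ℝ) : ℂ) * monicOrthogonalPoly μ n

open Classical in
/-- The number of solutions in `V` of `P z = w`, counted with multiplicity (for `P` not the constant
polynomial `w`). -/
def numSolutions (P : ℂ[X]) (w : ℂ) (V : Set ℂ) : ℕ :=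
  ((P - C w).roots.filter (fun z => z ∈ V)).card

end

/-! The proof is an extremal argument. The monic orthogonal polynomial has least L² norm among monic
polynomials of its degree, and for bounded `w` the monic multiple of `P_n - w` has squared norm at
most `2 + 2R²` times the minimum. Many zeros in `V` would cluster near some `z₀` in the unbounded
component; trading their linear factors for a monic `Q` of equal degree, smaller on the support by a
factor `ε`, would beat the minimum.

Such a `Q` comes from a Runge-type argument: on `S`, `z - z₀` is a uniform limit of polynomials `p`
in `v = 1/(z - z₀)`, so `1 - v p(v)` is small, and multiplying by a power of `z - z₀` makes it a
monic polynomial (`exists_monic_norm_le_mul_norm_sub_pow`). Non-polarity serves only to make the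
support infinite. -/

/-! ### Finite sets are polar -/

theorem logEnergyNeg_eq_top_of_atom {ν : Measure ℂ} {a : ℂ} (ha : ν {a} ≠ 0) :
    logEnergyNeg ν = ⊤ := by
  have h1 : ∫⁻ w, (-ENNReal.log ‖a - w‖ₑ).toENNReal ∂ν = ⊤ := by
    rw [eq_top_iff]
    calc (⊤ : ENNReal) = (-ENNReal.log ‖a - a‖ₑ).toENNReal * ν {a} := by
          simp [ENNReal.top_mul ha]
      _ = ∫⁻ w in {a}, (-ENNReal.log ‖a - w‖ₑ).toENNReal ∂ν := by
          rw [Measure.restrict_singleton, lintegral_smul_measure, lintegral_dirac, smul_eq_mul,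
            mul_comm]
      _ ≤ _ := setLIntegral_le_lintegral _ _
  rw [logEnergyNeg, eq_top_iff]
  calc (⊤ : ENNReal) = (∫⁻ w, (-ENNReal.log ‖a - w‖ₑ).toENNReal ∂ν) * ν {a} := by
        simp only [h1, ENNReal.top_mul ha]
    _ = ∫⁻ z in {a}, ∫⁻ w, (-ENNReal.log ‖z - w‖ₑ).toENNReal ∂ν ∂ν := by
        rw [Measure.restrict_singleton, lintegral_smul_measure, lintegral_dirac, smul_eq_mul,
            mul_comm]
    _ ≤ _ := setLIntegral_le_lintegral _ _

theorem exists_atom_of_finite_support {ν : Measure ℂ} [IsProbabilityMeasure ν]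
    (h : ν.support.Finite) : ∃ a, ν {a} ≠ 0 := by
  by_contra! hc
  have h0 : ν ν.support = 0 := (measure_null_iff_singleton h.countable).2 fun a _ => hc a
  have h1 : ν ν.supportᶜ = 0 := Measure.measure_compl_support
  have := measure_union_le (μ := ν) ν.support ν.supportᶜ
  rw [Set.union_compl_self, h0, h1] at this
  simp at this

theorem isPolar_of_finite {B : Set ℂ} (hB : B.Finite) : IsPolar B := by
  have : setEnergy B = ⊥ := by
    rw [setEnergy, sSup_eq_bot]
    rintro e ⟨ν, hν, -, hs, rfl⟩
    obtain ⟨a, ha⟩ := exists_atom_of_finite_support (hB.subset hs)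
    -- In `EReal`, `x - ⊤ = ⊥` even for `x = ⊤`, so the positive part needs no bound.
    rw [logEnergy, logEnergyNeg_eq_top_of_atom ha]
    simp
  simp [IsPolar, logCap, this]

/-! ### Orthogonality and minimality in L²(μ) -/

section LTwo

variable {μ : Measure ℂ}

theorem integrable_of_continuous_of_isCompact_support [IsFiniteMeasure μ]
    (hc : IsCompact μ.support) {E : Type*} [NormedAddCommGroup E] {f : ℂ → E}
    (hf : Continuous f) : Integrable f μ := by
  have h : μ.restrict μ.support = μ :=
    Measure.restrict_eq_self_of_ae_mem Measure.support_mem_ae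
  rw [← h]
  exact hf.continuousOn.integrableOn_compact hc

variable [IsProbabilityMeasure μ]

theorem polyInner_add_right (hc : IsCompact μ.support) (p q r : ℂ[X]) :
    polyInner μ p (q + r) = polyInner μ p q + polyInner μ p r := by
  simp only [polyInner, eval_add, mul_add]
  apply integral_add <;> exact integrable_of_continuous_of_isCompact_support hc (by fun_prop)

omit [IsProbabilityMeasure μ] in
theorem polyInner_C_mul_right (p q : ℂ[X]) (c : ℂ) :
    polyInner μ p (C c * q) = c * polyInner μ p q := by
  simp only [polyInner, ← integral_const_mul]
  congr 1; ext z; simp; ring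

theorem polyInner_sum_right (hc : IsCompact μ.support) {ι : Type*} (s : Finset ι) (p : ℂ[X])
    (q : ι → ℂ[X]) : polyInner μ p (∑ i ∈ s, q i) = ∑ i ∈ s, polyInner μ p (q i) := by
  simp only [polyInner, eval_finsetSum, Finset.mul_sum]
  apply integral_finsetSum
  intros; exact integrable_of_continuous_of_isCompact_support hc (by fun_prop)

theorem polyInner_sub_right (hc : IsCompact μ.support) (p q r : ℂ[X]) :
    polyInner μ p (q - r) = polyInner μ p q - polyInner μ p r := by
  simp only [polyInner, eval_sub, mul_sub]
  apply integral_sub <;> exact integrable_of_continuous_of_isCompact_support hc (by fun_prop)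

omit [IsProbabilityMeasure μ] in
theorem conj_polyInner (p q : ℂ[X]) :
    (starRingEnd ℂ) (polyInner μ p q) = polyInner μ q p := by
  simp only [polyInner, ← integral_conj]
  congr 1; ext z; simp [mul_comm]

omit [IsProbabilityMeasure μ] in
theorem polyInner_self (p : ℂ[X]) :
    polyInner μ p p = ((∫ z, ‖p.eval z‖ ^ 2 ∂μ : ℝ) : ℂ) := by
  rw [polyInner, ← integral_complex_ofReal]
  congr 1; ext z; simp [Complex.conj_mul']

theorem integral_norm_sq_pos (hc : IsCompact μ.support) (hi : μ.support.Infinite) {p : ℂ[X]}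
    (hp : p ≠ 0) : 0 < ∫ z, ‖p.eval z‖ ^ 2 ∂μ := by
  refine lt_of_le_of_ne (by positivity) fun h => ?_
  rw [eq_comm, integral_eq_zero_iff_of_nonneg (fun z => by positivity)
    (integrable_of_continuous_of_isCompact_support hc (by fun_prop))] at h
  -- A closed set of full measure contains the support.
  have hsub : μ.support ⊆ {z | p.eval z = 0} := by
    apply Measure.support_subset_of_isClosed (isClosed_eq (by fun_prop) continuous_const)
    filter_upwards [h] with z hz
    simpa using hz
  refine hi ((p.roots.toFinset.finite_toSet).subset fun z hz => ?_)
  simpa [hp] using hsub hz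

omit [IsProbabilityMeasure μ] in
theorem monicOrthogonalPoly_monic_degree (n : ℕ) :
    (monicOrthogonalPoly μ n).Monic ∧ (monicOrthogonalPoly μ n).degree = n := by
  induction n using Nat.strong_induction_on with
  | _ n ih =>
    have hlt : (∑ k : Fin n, C (polyInner μ (monicOrthogonalPoly μ k) (X ^ n) /
        polyInner μ (monicOrthogonalPoly μ k) (monicOrthogonalPoly μ k)) *
          monicOrthogonalPoly μ k).degree < n := by
      refine (degree_sum_le _ _).trans_lt
        ((Finset.sup_lt_iff (WithBot.bot_lt_coe n)).2 fun k _ => ?_)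
      refine (degree_mul_le_of_le degree_C_le (ih k k.2).2.le).trans_lt ?_
      rw [zero_add]
      exact Nat.cast_lt.2 k.2
    rw [monicOrthogonalPoly]
    refine ⟨monic_X_pow_sub hlt, ?_⟩
    rw [degree_sub_eq_left_of_degree_lt (by rwa [degree_X_pow]), degree_X_pow]

theorem polyInner_monicOrthogonalPoly_of_lt (hc : IsCompact μ.support)
    (hi : μ.support.Infinite) {n k : ℕ} (hk : k < n) :
    polyInner μ (monicOrthogonalPoly μ k) (monicOrthogonalPoly μ n) = 0 := by
  induction n using Nat.strong_induction_on generalizing k with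
  | _ n ih =>
    have h0 : polyInner μ (monicOrthogonalPoly μ k) (monicOrthogonalPoly μ k) ≠ 0 := by
      rw [polyInner_self, Complex.ofReal_ne_zero]
      exact (integral_norm_sq_pos hc hi (monicOrthogonalPoly_monic_degree k).1.ne_zero).ne'
    rw [monicOrthogonalPoly.eq_1 μ n]
    rw [polyInner_sub_right hc, polyInner_sum_right hc, Finset.sum_eq_single ⟨k, hk⟩]
    · rw [polyInner_C_mul_right, div_mul_cancel₀ _ h0, sub_self]
    · intro j _ hj
      rw [polyInner_C_mul_right]
      rcases lt_trichotomy k (j : ℕ) with h | h | h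
      · rw [ih j j.2 h, mul_zero]
      · exact absurd (Fin.ext h.symm) hj
      · rw [← conj_polyInner (monicOrthogonalPoly μ j) (monicOrthogonalPoly μ k), ih k hk h, map_zero, mul_zero]
    · simp

theorem polyInner_monicOrthogonalPoly_X_pow (hc : IsCompact μ.support)
    (hi : μ.support.Infinite) {n k : ℕ} (hk : k < n) :
    polyInner μ (monicOrthogonalPoly μ n) (X ^ k) = 0 := by
  have key : ∀ j < n, polyInner μ (monicOrthogonalPoly μ n) (monicOrthogonalPoly μ j) = 0 :=
    fun j hj => by
      rw [← conj_polyInner, polyInner_monicOrthogonalPoly_of_lt hc hi hj, map_zero]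
  have h := key k hk
  rw [monicOrthogonalPoly.eq_1 μ k, polyInner_sub_right hc, polyInner_sum_right hc,
    Finset.sum_eq_zero, sub_zero] at h
  · exact h
  · intro j _
    rw [polyInner_C_mul_right, key j (j.2.trans hk), mul_zero]

theorem polyInner_monicOrthogonalPoly_of_degree_lt (hc : IsCompact μ.support)
    (hi : μ.support.Infinite) {n : ℕ} {r : ℂ[X]} (hr : r.degree < n) :
    polyInner μ (monicOrthogonalPoly μ n) r = 0 := by
  rcases eq_or_ne r 0 with rfl | h0
  · simp [polyInner]
  rw [r.as_sum_range_C_mul_X_pow' ((natDegree_lt_iff_degree_lt h0).2 hr), polyInner_sum_right hc]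
  refine Finset.sum_eq_zero fun k hk => ?_
  rw [polyInner_C_mul_right,
    polyInner_monicOrthogonalPoly_X_pow hc hi (Finset.mem_range.1 hk), mul_zero]

/-- Pythagoras: leading terms cancel in `q - p`, which is therefore orthogonal to `p`. -/
theorem integral_norm_sq_monicOrthogonalPoly_le (hc : IsCompact μ.support)
    (hi : μ.support.Infinite) {n : ℕ} {q : ℂ[X]} (hq : q.Monic) (hn : q.natDegree = n) :
    ∫ z, ‖(monicOrthogonalPoly μ n).eval z‖ ^ 2 ∂μ ≤ ∫ z, ‖q.eval z‖ ^ 2 ∂μ := by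
  obtain ⟨hm, hd⟩ := monicOrthogonalPoly_monic_degree (μ := μ) n
  set p := monicOrthogonalPoly μ n
  have hr : (q - p).degree < n := by
    have hqd : q.degree = n := by rw [degree_eq_natDegree hq.ne_zero, hn]
    rw [← hqd]
    exact degree_sub_lt_left (hqd.trans hd.symm) hq.ne_zero (by rw [hq.leadingCoeff, hm.leadingCoeff])
  have h0 : polyInner μ p (q - p) = 0 := polyInner_monicOrthogonalPoly_of_degree_lt hc hi hr
  have h1 : polyInner μ (q - p) p = 0 := by rw [← conj_polyInner, h0, map_zero]
  have h2 : polyInner μ p q = polyInner μ p p := by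
    rwa [polyInner_sub_right hc, sub_eq_zero] at h0
  have h3 : polyInner μ q p = polyInner μ p p := by
    rw [← conj_polyInner, h2, conj_polyInner]
  have h4 : polyInner μ (q - p) (q - p) = polyInner μ q q - polyInner μ p p := by
    rw [polyInner_sub_right hc, h1, sub_zero, ← conj_polyInner, polyInner_sub_right hc, h3,
      map_sub, conj_polyInner, conj_polyInner]
  simp only [polyInner_self, ← Complex.ofReal_sub, Complex.ofReal_inj] at h4
  have h5 : 0 ≤ ∫ z, ‖(q - p).eval z‖ ^ 2 ∂μ := by positivity
  linarith

end LTwo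

/-! ### Resolvents in closed subalgebras -/

section Resolvent

variable {A : Type*} [NormedRing A] [NormedAlgebra ℂ A] [CompleteSpace A]

theorem Subalgebra.inverse_one_sub_mem {B : Subalgebra ℂ A} (hB : IsClosed (B : Set A)) {x : A}
    (hx : x ∈ B) (h : ‖x‖ < 1) : Ring.inverse (1 - x) ∈ B := by
  rw [NormedRing.inverse_one_sub x h]
  exact hB.mem_of_tendsto (summable_geometric_of_norm_lt_one h).hasSum
    (Filter.Eventually.of_forall fun s => B.sum_mem fun i _ => B.pow_mem hx i)

/-- If a closed subalgebra contains one resolvent of `a`, at a point of an unbounded component of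
the resolvent set, then it contains `a`. -/
theorem Subalgebra.mem_of_resolvent_mem {B : Subalgebra ℂ A} (hB : IsClosed (B : Set A)) {a : A}
    {l : ℂ} (hl : l ∈ resolventSet ℂ a) (hmem : resolvent a l ∈ B)
    (hub : ¬ Bornology.IsBounded (connectedComponentIn (resolventSet ℂ a) l)) : a ∈ B := by
  set T : Set ℂ := {k | k ∈ resolventSet ℂ a ∧ resolvent a k ∈ B}
  -- Neumann series for `k' - a = (k - a)(1 - (k - k') R(k))`, where `R` is the resolvent.
  have hTo : IsOpen T := by
    rw [isOpen_iff_mem_nhds]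
    rintro k ⟨hk, hkB⟩
    obtain ⟨u, hu⟩ : IsUnit (algebraMap ℂ A k - a) := hk
    have hlim : Filter.Tendsto (fun k' : ℂ => ‖(k - k') • resolvent a k‖) (nhds k) (nhds 0) := by
      have : Continuous (fun k' : ℂ => ‖(k - k') • resolvent a k‖) := by fun_prop
      simpa using this.tendsto k
    filter_upwards [hlim.eventually (gt_mem_nhds one_pos)] with k' hk'
    have hfac : algebraMap ℂ A k' - a =
        ((u * Units.oneSub _ hk' : Aˣ) : A) := by
      rw [Units.val_mul, Units.val_oneSub, hu, mul_sub, mul_one, mul_smul_comm,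
        resolvent, Ring.mul_inverse_cancel _ ⟨u, hu⟩, ← Algebra.algebraMap_eq_smul_one, map_sub]
      abel
    refine ⟨⟨_, hfac.symm⟩, ?_⟩
    rw [resolvent, hfac, Ring.inverse_unit, mul_inv_rev, Units.val_mul, ← Ring.inverse_unit,
      ← Ring.inverse_unit, Units.val_oneSub, hu]
    exact B.mul_mem (B.inverse_one_sub_mem hB (B.smul_mem hkB _) hk') hkB
  have hcl : closure T ∩ connectedComponentIn (resolventSet ℂ a) l ⊆ T := by
    rintro k ⟨hk, hkc⟩
    have hkr := connectedComponentIn_subset _ _ hkc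
    refine ⟨hkr, ?_⟩
    have hcont : ContinuousAt (resolvent a) k :=
      (spectrum.hasDerivAt_resolvent_const_left hkr).continuousAt
    have := hcont.continuousWithinAt.mem_closure hk (fun x (hx : x ∈ T) => (hx.2 : _ ∈ (B : Set A)))
    rwa [hB.closure_eq] at this
  have hsub : connectedComponentIn (resolventSet ℂ a) l ⊆ T :=
    isPreconnected_connectedComponentIn.subset_of_closure_inter_subset hTo
      ⟨l, mem_connectedComponentIn hl, hl, hmem⟩ hcl
  have hlim : Filter.Tendsto (fun k : ℂ => ‖a * resolvent a k‖) (Bornology.cobounded ℂ)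
      (nhds 0) := by
    simpa using ((spectrum.resolvent_tendsto_cobounded (𝕜 := ℂ) a).const_mul a).norm
  -- `T` contains the unbounded component, so it has points with `a R(k)` small. Then `k R(k) = 1 +
  -- a R(k)` is invertible within `B`, which recovers `k - a`.
  obtain ⟨k, hkT, hk⟩ : ∃ k ∈ T, ‖a * resolvent a k‖ < 1 := by
    by_contra! hcon
    refine hub (Bornology.isBounded_def.2 ?_)
    filter_upwards [hlim.eventually (gt_mem_nhds one_pos)] with k hk hkc
    exact absurd hk (not_lt.2 (hcon k (hsub hkc)))
  have hmul : resolvent a k * (algebraMap ℂ A k - a) = 1 := Ring.inverse_mul_cancel _ hkT.1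
  have hmul' : (algebraMap ℂ A k - a) * resolvent a k = 1 := Ring.mul_inverse_cancel _ hkT.1
  have hx : 1 - algebraMap ℂ A k * resolvent a k = -(a * resolvent a k) := by
    rw [← hmul']; noncomm_ring
  have hlt : ‖1 - algebraMap ℂ A k * resolvent a k‖ < 1 := by rwa [hx, norm_neg]
  have hinv := B.inverse_one_sub_mem hB
    (B.sub_mem B.one_mem (B.mul_mem (B.algebraMap_mem k) hkT.2)) hlt
  have hunit : IsUnit (1 - (1 - algebraMap ℂ A k * resolvent a k)) :=
    (Units.oneSub _ hlt).isUnit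
  rw [sub_sub_cancel] at hinv hunit
  have key : algebraMap ℂ A k - a =
      Ring.inverse (algebraMap ℂ A k * resolvent a k) * algebraMap ℂ A k := by
    calc algebraMap ℂ A k - a
        = Ring.inverse (algebraMap ℂ A k * resolvent a k) * (algebraMap ℂ A k * resolvent a k) *
          (algebraMap ℂ A k - a) := by rw [Ring.inverse_mul_cancel _ hunit, one_mul]
      _ = _ := by rw [mul_assoc, mul_assoc, hmul, mul_one]
  have : a = algebraMap ℂ A k - (algebraMap ℂ A k - a) := by abel
  rw [this]
  exact B.sub_mem (B.algebraMap_mem k) (key ▸ B.mul_mem hinv (B.algebraMap_mem k))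

end Resolvent

/-! ### Small monic polynomials -/

/-- Polynomials that are small on a compact set compared with a power of the distance to a point
of the unbounded component of its complement. -/
theorem exists_monic_norm_le_mul_norm_sub_pow {S : Set ℂ} (hS : IsCompact S) {z₀ : ℂ}
    (hz₀ : z₀ ∈ unboundedComponent S) {ε : ℝ} (hε : 0 < ε) :
    ∃ Q : ℂ[X], Q.Monic ∧ ∀ z ∈ S, ‖Q.eval z‖ ≤ ε * ‖z - z₀‖ ^ Q.natDegree := by
  have : CompactSpace S := isCompact_iff_compactSpace.1 hS
  let a : C(S, ℂ) := ⟨fun x => x, continuous_subtype_val⟩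
  have hres : resolventSet ℂ a = Sᶜ := by
    have : spectrum ℂ a = S := by
      rw [ContinuousMap.spectrum_eq_range]; exact Subtype.range_coe
    rw [← compl_compl (resolventSet ℂ a)]
    exact congrArg _ this
  have hmem : z₀ ∈ resolventSet ℂ a := hres ▸ hz₀.1
  -- The sign makes `v` the function `1/(x - z₀)`.
  set v : C(S, ℂ) := -resolvent a z₀ with hv
  set B := (Algebra.adjoin ℂ {v}).topologicalClosure
  have hvB : v ∈ B := Subalgebra.le_topologicalClosure _ (Algebra.self_mem_adjoin_singleton ℂ v)
  have haB : a ∈ B := B.mem_of_resolvent_mem (Subalgebra.isClosed_topologicalClosure _) hmem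
    (by simpa [hv] using B.neg_mem hvB) (by rw [hres]; exact hz₀.2)
  have hbB : a - algebraMap ℂ _ z₀ ∈ B := B.sub_mem haB (B.algebraMap_mem z₀)
  have hvb : v * (a - algebraMap ℂ _ z₀) = 1 := by
    rw [← Ring.inverse_mul_cancel _ hmem, hv, resolvent]; ring
  have hvx : ∀ x : S, v x * (x - z₀) = 1 := fun x =>
    congrArg (fun f : C(S, ℂ) => f x) hvb
  obtain ⟨f, hf, hfb⟩ := Metric.mem_closure_iff.1
    (show a - algebraMap ℂ _ z₀ ∈ closure (Algebra.adjoin ℂ {v} : Set C(S, ℂ)) from hbB)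
    (ε / (‖v‖ + 1)) (by positivity)
  rw [SetLike.mem_coe, Algebra.adjoin_singleton_eq_range_aeval] at hf
  obtain ⟨p, rfl⟩ := hf
  set d := p.natDegree
  -- With `y = 1/x`, `q(x) = x^(d+1) (1 - y p(y)) = x^(d+1) y (x - p(y))`; the last factor is small
  -- by the choice of `p`.
  set q : ℂ[X] := X ^ (d + 1) - ∑ i ∈ Finset.range (d + 1), C (p.coeff i) * X ^ (d - i) with hq
  have hlt : (∑ i ∈ Finset.range (d + 1), C (p.coeff i) * X ^ (d - i)).degree <
      ((d + 1 : ℕ) : WithBot ℕ) := by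
    refine (degree_sum_le _ _).trans_lt
      ((Finset.sup_lt_iff (WithBot.bot_lt_coe _)).2 fun i _ => ?_)
    exact (degree_C_mul_X_pow_le _ _).trans_lt (Nat.cast_lt.2 (by omega))
  have hqm : q.Monic := monic_X_pow_sub hlt
  have hqd : q.natDegree = d + 1 := natDegree_eq_of_degree_eq_some (by
    rw [degree_sub_eq_left_of_degree_lt (by rwa [degree_X_pow]), degree_X_pow])
  refine ⟨q.comp (X - C z₀), hqm.comp_X_sub_C z₀, fun z hz => ?_⟩
  rw [natDegree_comp, hqd, natDegree_X_sub_C, mul_one]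
  have hx := hvx ⟨z, hz⟩
  simp only at hx
  set y := v ⟨z, hz⟩
  have heval : (q.comp (X - C z₀)).eval z =
      (y * ((z - z₀) - p.eval y)) * (z - z₀) ^ (d + 1) := by
    rw [mul_sub, hx, eval_comp, hq, eval_eq_sum_range (p := p), sub_mul, one_mul]
    simp only [eval_sub, eval_X, eval_C, eval_pow, eval_finsetSum, eval_mul]
    congr 1
    rw [mul_assoc, Finset.sum_mul, Finset.mul_sum]
    refine Finset.sum_congr rfl fun i hi => ?_
    have hi' : d + 1 = (d - i) + (i + 1) := by have := Finset.mem_range.1 hi; omega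
    calc p.coeff i * (z - z₀) ^ (d - i)
        = p.coeff i * (z - z₀) ^ (d - i) * (y * (z - z₀)) ^ (i + 1) := by rw [hx]; ring
      _ = y * (p.coeff i * y ^ i * (z - z₀) ^ ((d - i) + (i + 1))) := by
        rw [mul_pow, pow_add _ (d - i)]; ring
      _ = _ := by rw [← hi']
  rw [heval, norm_mul, norm_pow, norm_mul]
  refine mul_le_mul_of_nonneg_right ?_ (by positivity)
  have h1 : ‖y‖ ≤ ‖v‖ := v.norm_coe_le_norm _
  have h2 : ‖(z - z₀) - p.eval y‖ ≤ ε / (‖v‖ + 1) := by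
    have h3 := (a - algebraMap ℂ _ z₀ - aeval v p).norm_coe_le_norm ⟨z, hz⟩
    rw [← dist_eq_norm] at h3
    have h4 : (aeval v p) ⟨z, hz⟩ = p.eval y := by
      rw [aeval_eq_sum_range, eval_eq_sum_range]
      simp [y]
    have h5 : (a - algebraMap ℂ _ z₀ - aeval v p) ⟨z, hz⟩ = (z - z₀) - p.eval y := by
      rw [ContinuousMap.sub_apply, h4]; simp [a]
    rw [h5] at h3
    exact h3.trans hfb.le
  calc ‖y‖ * ‖(z - z₀) - p.eval y‖ ≤ (‖v‖ + 1) * (ε / (‖v‖ + 1)) := by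
        gcongr; linarith
    _ = ε := by field_simp

theorem Multiset.exists_le_card_eq {α : Type*} {T : Multiset α} {m : ℕ} (h : m ≤ T.card) :
    ∃ T' ≤ T, T'.card = m := by
  induction T using Quotient.inductionOn with
  | _ l => exact ⟨(l.take m : List α), (List.take_sublist m l).subperm, by simpa using h⟩

theorem pow_card_le_norm_eval_prod_X_sub_C {T : Multiset ℂ} {z : ℂ} {c : ℝ} (hc : 0 ≤ c)
    (h : ∀ t ∈ T, c ≤ ‖z - t‖) : c ^ T.card ≤ ‖(T.map (fun t => X - C t)).prod.eval z‖ := by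
  induction T using Multiset.induction_on with
  | empty => simp
  | cons t T ih =>
    simp only [Multiset.card_cons, Multiset.map_cons, Multiset.prod_cons, eval_mul, eval_sub,
      eval_X, eval_C, norm_mul]
    rw [pow_succ']
    exact mul_le_mul (h t (Multiset.mem_cons_self t T))
      (ih fun s hs => h s (Multiset.mem_cons_of_mem hs)) (by positivity) (norm_nonneg _)

/-- Near a point of the unbounded component, a product of sufficiently many linear factors can be
replaced by a monic polynomial that is much smaller on `S`. -/
theorem exists_nhds_monic_norm_le {S : Set ℂ} (hS : IsCompact S) {z₀ : ℂ}
    (hz₀ : z₀ ∈ unboundedComponent S) {ε : ℝ} (hε : 0 < ε) :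
    ∃ U ∈ nhds z₀, ∃ Q : ℂ[X], Q.Monic ∧ ∀ T : Multiset ℂ, T.card = Q.natDegree →
      (∀ t ∈ T, t ∈ U) →
        ∀ z ∈ S, ‖Q.eval z‖ ≤ ε * ‖(T.map (fun t => X - C t)).prod.eval z‖ := by
  obtain ⟨Q, hQm, hQ⟩ := exists_monic_norm_le_mul_norm_sub_pow hS hz₀ (half_pos hε)
  obtain ⟨r, hr, hrS⟩ := Metric.isOpen_iff.1 hS.isClosed.isOpen_compl z₀ hz₀.1
  set m := Q.natDegree
  -- Chosen so that Bernoulli gives `(1 - δ)^m ≥ 1/2`, the loss in moving `m` zeros from `z₀` into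
  -- the ball; `ε / 2` above pays for it.
  set δ : ℝ := (2 * m + 2 : ℝ)⁻¹ with hδ
  have hδ0 : 0 < δ := by positivity
  have hmδ : m * δ ≤ 1 / 2 := by
    rw [hδ, ← div_eq_mul_inv, div_le_div_iff₀ (by positivity) two_pos]; linarith
  have hδ1 : δ ≤ 1 := inv_le_one_of_one_le₀ (by linarith [(Nat.cast_nonneg m : (0 : ℝ) ≤ m)])
  refine ⟨Metric.ball z₀ (δ * r), Metric.ball_mem_nhds _ (by positivity), Q, hQm,
    fun T hT hTU z hz => (hQ z hz).trans ?_⟩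
  have hzr : r ≤ ‖z - z₀‖ := by
    by_contra! hlt
    exact hrS (mem_ball_iff_norm.2 hlt) hz
  have hle : ∀ t ∈ T, (1 - δ) * ‖z - z₀‖ ≤ ‖z - t‖ := fun t ht => by
    have h1 : ‖t - z₀‖ < δ * r := mem_ball_iff_norm.1 (hTU t ht)
    have h2 : ‖z - z₀‖ ≤ ‖z - t‖ + ‖t - z₀‖ := norm_sub_le_norm_sub_add_norm_sub _ _ _
    nlinarith
  have hprod := pow_card_le_norm_eval_prod_X_sub_C
    (mul_nonneg (sub_nonneg.2 hδ1) (norm_nonneg _)) hle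
  have hbern : 1 / 2 ≤ (1 - δ) ^ m := by
    have := one_add_mul_le_pow (a := -δ) (by linarith) m
    rw [← sub_eq_add_neg] at this
    linarith
  rw [hT, mul_pow] at hprod
  calc ε / 2 * ‖z - z₀‖ ^ m = ε * (1 / 2 * ‖z - z₀‖ ^ m) := by ring
    _ ≤ ε * ((1 - δ) ^ m * ‖z - z₀‖ ^ m) := by gcongr
    _ ≤ _ := by gcongr

/-- Compactness induction from the local version; for a union of two sets the bounds add, by
pigeonhole. -/
theorem exists_card_bound_monic_norm_le {S V : Set ℂ} (hS : IsCompact S) (hV : IsCompact V)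
    (hVS : V ⊆ unboundedComponent S) {ε : ℝ} (hε : 0 < ε) :
    ∃ M : ℕ, ∀ T : Multiset ℂ, M ≤ T.card → (∀ t ∈ T, t ∈ V) →
      ∃ T' ≤ T, ∃ Q : ℂ[X], Q.Monic ∧ Q.natDegree = T'.card ∧
        ∀ z ∈ S, ‖Q.eval z‖ ≤ ε * ‖(T'.map (fun t => X - C t)).prod.eval z‖ := by
  classical
  refine hV.induction_on (p := fun V => ∃ M : ℕ, ∀ T : Multiset ℂ, M ≤ T.card →
    (∀ t ∈ T, t ∈ V) → ∃ T' ≤ T, ∃ Q : ℂ[X], Q.Monic ∧ Q.natDegree = T'.card ∧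
      ∀ z ∈ S, ‖Q.eval z‖ ≤ ε * ‖(T'.map (fun t => X - C t)).prod.eval z‖) ?_ ?_ ?_ ?_
  · refine ⟨1, fun T hT h => ?_⟩
    obtain ⟨t, ht⟩ := Multiset.card_pos_iff_exists_mem.1 hT
    exact absurd (h t ht) (Set.notMem_empty t)
  · rintro s t hst ⟨M, hM⟩
    exact ⟨M, fun T hT h => hM T hT fun x hx => hst (h x hx)⟩
  · rintro s t ⟨M, hM⟩ ⟨N, hN⟩
    refine ⟨M + N, fun T hT h => ?_⟩
    have hcard : (T.filter (· ∈ s)).card + (T.filter (¬ · ∈ s)).card = T.card := by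
      rw [← Multiset.card_add, Multiset.filter_add_not]
    rcases le_or_gt M (T.filter (· ∈ s)).card with hle | hlt
    · obtain ⟨T', hT', hQ⟩ := hM _ hle fun x hx => (Multiset.mem_filter.1 hx).2
      exact ⟨T', hT'.trans (Multiset.filter_le _ _), hQ⟩
    · obtain ⟨T', hT', hQ⟩ := hN (T.filter (¬ · ∈ s)) (by omega) fun x hx =>
        (h x (Multiset.mem_filter.1 hx).1).resolve_left (Multiset.mem_filter.1 hx).2
      exact ⟨T', hT'.trans (Multiset.filter_le _ _), hQ⟩
  · intro z₀ hz₀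
    obtain ⟨U, hU, Q, hQm, hQ⟩ := exists_nhds_monic_norm_le hS (hVS hz₀) hε
    refine ⟨U, mem_nhdsWithin_of_mem_nhds hU, Q.natDegree, fun T hT h => ?_⟩
    obtain ⟨T', hT', hcard⟩ := Multiset.exists_le_card_eq hT
    exact ⟨T', hT', Q, hQm, hcard.symm, hQ T' hcard fun t ht => h t (Multiset.mem_of_le hT' ht)⟩

/-! ### Zeros of nearly minimal polynomials -/

theorem integral_norm_sq_le_mul {μ : Measure ℂ} [IsProbabilityMeasure μ]
    (hc : IsCompact μ.support) {p q : ℂ[X]} {ε : ℝ}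
    (h : ∀ z ∈ μ.support, ‖q.eval z‖ ≤ ε * ‖p.eval z‖) :
    ∫ z, ‖q.eval z‖ ^ 2 ∂μ ≤ ε ^ 2 * ∫ z, ‖p.eval z‖ ^ 2 ∂μ := by
  rw [← integral_const_mul]
  refine integral_mono_ae (integrable_of_continuous_of_isCompact_support hc (by fun_prop))
    (integrable_of_continuous_of_isCompact_support hc (by fun_prop)) ?_
  filter_upwards [Measure.support_mem_ae (μ := μ)] with z hz
  rw [← mul_pow]
  gcongr
  exact h z hz

/-- A monic polynomial of degree `n` whose `L²` norm exceeds the minimal one by at most a fixed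
factor has a bounded number of zeros on compact subsets of the unbounded component. -/
theorem exists_bound_card_roots_filter {μ : Measure ℂ} [IsProbabilityMeasure μ]
    (hc : IsCompact μ.support) (hi : μ.support.Infinite) {V : Set ℂ} (hV : IsCompact V)
    (hVS : V ⊆ unboundedComponent μ.support) (K : ℝ) :
    ∃ M : ℕ, ∀ p : ℂ[X], p.Monic →
      ∫ z, ‖p.eval z‖ ^ 2 ∂μ ≤ K * ∫ z, ‖(monicOrthogonalPoly μ p.natDegree).eval z‖ ^ 2 ∂μ →
      ∀ T ≤ p.roots, (∀ t ∈ T, t ∈ V) → T.card < M := by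
  obtain ⟨ε, hε, hεK⟩ : ∃ ε : ℝ, 0 < ε ∧ ε ^ 2 * K < 1 := by
    have hlim : Filter.Tendsto (fun ε : ℝ => ε ^ 2 * K) (nhdsWithin 0 (Set.Ioi 0)) (nhds 0) := by
      have : Continuous (fun ε : ℝ => ε ^ 2 * K) := by fun_prop
      simpa using (this.tendsto 0).mono_left nhdsWithin_le_nhds
    have hev : ∀ᶠ ε in nhdsWithin (0 : ℝ) (Set.Ioi 0), 0 < ε ∧ ε ^ 2 * K < 1 :=
      Filter.Eventually.and self_mem_nhdsWithin (hlim.eventually (gt_mem_nhds one_pos))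
    exact hev.exists
  obtain ⟨M, hM⟩ := exists_card_bound_monic_norm_le hc hV hVS hε
  refine ⟨M, fun p hp hpK T hT hTV => ?_⟩
  by_contra! hcard
  obtain ⟨T', hT', Q, hQm, hQd, hQ⟩ := hM T hcard hTV
  obtain ⟨h, hph⟩ := (Multiset.prod_X_sub_C_dvd_iff_le_roots hp.ne_zero T').2 (hT'.trans hT)
  have hTm : (T'.map (fun t => X - C t)).prod.Monic := monic_multiset_prod_of_monic _ _
    fun t _ => monic_X_sub_C t
  have hhm : h.Monic := hTm.of_mul_monic_left (hph ▸ hp)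
  have hdeg : (Q * h).natDegree = p.natDegree := by
    rw [hQm.natDegree_mul hhm, hph, hTm.natDegree_mul hhm, hQd,
      natDegree_multiset_prod_X_sub_C_eq_card]
  have hmin := integral_norm_sq_monicOrthogonalPoly_le hc hi (hQm.mul hhm) hdeg
  have hle := integral_norm_sq_le_mul hc (p := p) (q := Q * h) (ε := ε) fun z hz => by
    rw [hph, eval_mul, eval_mul, norm_mul, norm_mul, ← mul_assoc]
    gcongr
    exact hQ z hz
  have hpos := integral_norm_sq_pos hc hi
    (monicOrthogonalPoly_monic_degree (μ := μ) p.natDegree).1.ne_zero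
  -- The competitor `Q * h` yields minimum `≤ ε² K ·` minimum, although `ε² K < 1`.
  nlinarith [mul_le_mul_of_nonneg_left hpK (sq_nonneg ε)]

/-! ### Counting solutions of `P_n = w` -/

theorem numSolutions_orthonormalPoly_eq {μ : Measure ℂ} {n : ℕ} {c w : ℂ} {V : Set ℂ}
    (hc : c ≠ 0) :
    numSolutions (C c * monicOrthogonalPoly μ n) w V =
      numSolutions (monicOrthogonalPoly μ n) (c⁻¹ * w) V := by
  have : C c * monicOrthogonalPoly μ n - C w =
      C c * (monicOrthogonalPoly μ n - C (c⁻¹ * w)) := by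
    rw [mul_sub, ← C_mul, mul_inv_cancel_left₀ hc]
  rw [numSolutions, this, roots_C_mul _ hc, numSolutions]

theorem encard_preimage_inter_le_numSolutions {P : ℂ[X]} {w : ℂ} (hP : P - C w ≠ 0) (V : Set ℂ) :
    ((fun z : ℂ => P.eval z) ⁻¹' {w} ∩ V).encard ≤ (numSolutions P w V : ℕ∞) := by
  classical
  have hsub : (fun z : ℂ => P.eval z) ⁻¹' {w} ∩ V ⊆
      (((P - C w).roots.filter (fun z => z ∈ V)).toFinset : Set ℂ) := by
    rintro z ⟨hz, hzV⟩
    have hz' : P.eval z = w := hz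
    simp [hP, hz', hzV]
  refine (Set.encard_le_encard hsub).trans ?_
  rw [Set.encard_coe_eq_coe_finsetCard, numSolutions]
  refine Nat.cast_le.2 ((Multiset.toFinset_card_le _).trans_eq ?_)
  congr!

theorem integral_norm_sq_sub_C_le {μ : Measure ℂ} [IsProbabilityMeasure μ]
    (hc : IsCompact μ.support) (p : ℂ[X]) (w : ℂ) :
    ∫ z, ‖(p - C w).eval z‖ ^ 2 ∂μ ≤ 2 * ∫ z, ‖p.eval z‖ ^ 2 ∂μ + 2 * ‖w‖ ^ 2 := by
  have hint := integrable_of_continuous_of_isCompact_support hc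
    (f := fun z => 2 * ‖p.eval z‖ ^ 2) (by fun_prop)
  calc ∫ z, ‖(p - C w).eval z‖ ^ 2 ∂μ ≤ ∫ z, (2 * ‖p.eval z‖ ^ 2 + 2 * ‖w‖ ^ 2) ∂μ := by
        refine integral_mono (integrable_of_continuous_of_isCompact_support hc (by fun_prop))
          (hint.add (integrable_const _)) fun z => ?_
        simp only [eval_sub, eval_C]
        nlinarith [norm_sub_le (p.eval z) w, norm_nonneg (p.eval z - w),
          sq_nonneg (‖p.eval z‖ - ‖w‖)]
    _ = _ := by
        rw [integral_add hint (integrable_const _), integral_const_mul]; simp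

theorem mainTheorem2 (R : ℝ) (hR : 0 < R) (μ : Measure ℂ) (hμ : MemClassB μ)
    (V : Set ℂ) (hV : IsCompact V) (hVK : V ∩ filledSet μ.support = ∅) :
    ∃ M : ℕ, ∀ n : ℕ, 1 ≤ n → ∀ w : ℂ, ‖w‖ ≤ R →
      ((fun z : ℂ => (orthonormalPoly μ n).eval z) ⁻¹' {w} ∩ V).encard < (M : ℕ∞) ∧
      numSolutions (orthonormalPoly μ n) w V < M := by
  have := hμ.isProbabilityMeasure
  have hc := hμ.isCompact_support
  have hi : μ.support.Infinite := fun h => hμ.not_isPolar_support (isPolar_of_finite h)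
  have hVS : V ⊆ unboundedComponent μ.support :=
    Set.disjoint_compl_right_iff_subset.1 (Set.disjoint_iff_inter_eq_empty.2 hVK)
  obtain ⟨M, hM⟩ := exists_bound_card_roots_filter hc hi hV hVS (2 + 2 * R ^ 2)
  refine ⟨M, fun n hn w hw => ?_⟩
  obtain ⟨hm, hd⟩ := monicOrthogonalPoly_monic_degree (μ := μ) n
  have hpos := integral_norm_sq_pos hc hi hm.ne_zero
  set p := monicOrthogonalPoly μ n
  set c : ℂ := (((polyNorm μ p)⁻¹ : ℝ) : ℂ) with hcdef
  have hN : 0 < polyNorm μ p := Real.sqrt_pos.2 hpos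
  have hc0 : c ≠ 0 := Complex.ofReal_ne_zero.2 (inv_ne_zero hN.ne')
  -- Here `1 ≤ n` matters: subtracting a constant keeps `p` monic of degree `n`.
  have hlt : ∀ x : ℂ, (C x).degree < p.degree := fun x =>
    degree_C_le.trans_lt (by rw [hd]; exact_mod_cast hn)
  classical
  have hnum : numSolutions (orthonormalPoly μ n) w V < M := by
    rw [orthonormalPoly, numSolutions_orthonormalPoly_eq hc0, numSolutions]
    have hdeg : (p - C (c⁻¹ * w)).natDegree = n := natDegree_eq_of_degree_eq_some (by
      rw [degree_sub_eq_left_of_degree_lt (hlt _), hd])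
    refine hM (p - C (c⁻¹ * w)) (hm.sub_of_left (hlt _)) ?_ _ (Multiset.filter_le _ _)
      fun t ht => (Multiset.mem_filter.1 ht).2
    rw [hdeg]
    refine (integral_norm_sq_sub_C_le hc p _).trans ?_
    -- The shift `c⁻¹ w` scales with the norm of `p`, so the ratio to the minimum is bounded
    -- independently of `n`.
    have hnorm : ‖c⁻¹ * w‖ ^ 2 = ‖w‖ ^ 2 * ∫ z, ‖p.eval z‖ ^ 2 ∂μ := by
      rw [hcdef, norm_mul, norm_inv, Complex.norm_real, norm_inv, inv_inv, mul_pow,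
        Real.norm_of_nonneg hN.le, polyNorm, Real.sq_sqrt hpos.le, mul_comm]
    rw [hnorm]
    have : ‖w‖ ^ 2 ≤ R ^ 2 := by gcongr
    nlinarith
  refine ⟨(encard_preimage_inter_le_numSolutions (fun h0 => ?_) V).trans_lt
    (by exact_mod_cast hnum), hnum⟩
  have h1 : (orthonormalPoly μ n).degree = n := by
    rw [orthonormalPoly, degree_C_mul hc0, hd]
  have h2 : (C w).degree < (orthonormalPoly μ n).degree := by rw [h1, ← hd]; exact hlt w
  exact h2.ne' (congrArg degree (sub_eq_zero.1 h0))
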